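/- **Theorem (CPM is a precausal category).** Let $\mathbf{CPM}$ be the category whose objects are the matrix algebras $\mathcal L(H)$ of finite-dimensional complex Hilbert spaces $H=\mathbb C^{\iota}$ ($\iota$ a finite set, possibly empty) and whose morphisms are the completely positive linear maps. It is symmetric monoidal with $\mathcal L(H)\otimes\mathcal L(K)=\mathcal L(H\otimes K)$, $(\Phi\otimes\Psi)(a\otimes b)=\Phi(a)\otimes\Psi(b)$ and unit $I=\mathcal L(\mathbb C)$, and compact closed with $\mathcal L(H)^*=\mathcal L(H)$, cup $\eta=|\Phi_0\rangle\langle\Phi_0|$ and cap $\epsilon(\rho)=\langle\Phi_0|\rho|\Phi_0\rangle$, where $|\Phi_0\rangle=\sum_i|i\rangle\otimes|i\rangle$. For each object $A$ let the discarding map $\top_A:A\to I$ be the trace. Call a morphism $f:A\to B$ *causal* if $\top_B\circ f=\top_A$. Let the uniform state of $A$ be the transpose $(\top_{A^*}\otimes 1_A)\circ\eta_A: I\to A$, and let the *dimension* $d_A: I\to I$ be $\top_A$ applied to the uniform state of $A$. Then: - **(C1)** $\top_{A\otimes B}=\top_A\otimes\top_B$ for all $A,B$, and $\top_I=1_I$.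 - **(C2)** For every $A$ that is not a zero object, $d_A$ is an invertible scalar. In fact, for every $A=\mathcal L(H)$, $d_A=\dim H$. Moreover the closed loop $\epsilon_A\circ\sigma\circ\eta_A$ ($\sigma$ the swap) equals $(\dim H)^2$, and it too is invertible for every non-zero $A$. - **(C3)** If $f,g:A\to B$ satisfy $f\circ\rho=g\circ\rho$ for all causal states $\rho:I\to A$, then $f=g$. - **(C4)** Let $w:I\to A^*\otimes B\otimes C^*\otimes D$, regarded (by means of caps) as a map sending each $\Phi:B\to C$ to a process $w[\Phi]:A\to D$. If $w[\Phi]$ is causal for every causal $\Phi:B\to C$, then there are an object $Z$ and causal $\Phi_1:A\to B\otimes Z$ and $\Phi_2:C\otimes Z\to D$ such that $w$ is the comb formed by $\Phi_1$ followed by $\Phi_2$, with memory wire $Z$ and with an open hole in place of a process $B\to C$. - **(C4')** (Semicausal channels are semilocalizable.) If $\Phi:A\otimes B\to A'\otimes B'$ satisfies $(1_{A'}\otimes\top_{B'})\circ\Phi=\Phi'\otimes\top_B$ for some causal $\Phi':A\to A'$, then there are an object $Z$ and causal $\Phi_1:A\to A'\otimes Z$, $\Phi_2:Z\otimes B\to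 B'$ with $\Phi=(1_{A'}\otimes\Phi_2)\circ(\Phi_1\otimes 1_B)$. - **(C5')** Let $w:I\to A\otimes B^*$. If $\epsilon_B\circ(\Phi\otimes 1_{B^*})\circ w=1$ for every causal $\Phi:A\to B$, then $w=\rho\otimes\top_B^{\mathsf T}$ for some causal state $\rho:I\to A$, where $\top_B^{\mathsf T}: I\to B^*$ is $\top_B$ with its input bent up. In particular $\mathbf{CPM}$ is a precausal category, i.e. a compact closed category with discarding maps satisfying (C1)–(C4). -/

import Mathlib

open CategoryTheory MonoidalCategory
open scoped Matrix Kronecker ComplexOrder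

/-! ## Precausal axioms in a compact closed category

A compact closed category is a symmetric monoidal category in which every object `A` has a
dual `ᘁA`, with cup `η_ (ᘁA) A : 𝟙_ 𝒞 ⟶ ᘁA ⊗ A` and cap `ε_ (ᘁA) A : A ⊗ ᘁA ⟶ 𝟙_ 𝒞`. -/

namespace Precausal

variable {𝒞 : Type*} [Category 𝒞] [MonoidalCategory 𝒞] [SymmetricCategory 𝒞]
  [LeftRigidCategory 𝒞]

/-- The cup `I ⟶ A* ⊗ A`. -/
def cup (A : 𝒞) : 𝟙_ 𝒞 ⟶ (ᘁA) ⊗ A := η_ (ᘁA) A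

/-- The cap `A ⊗ A* ⟶ I`. -/
def cap (A : 𝒞) : A ⊗ (ᘁA) ⟶ 𝟙_ 𝒞 := ε_ (ᘁA) A

/-- The state of `A* ⊗ B` corresponding to a process `A ⟶ B`. -/
def stateOf {A B : 𝒞} (f : A ⟶ B) : 𝟙_ 𝒞 ⟶ (ᘁA) ⊗ B := cup A ≫ (ᘁA) ◁ f

/-- The process `A ⟶ B` corresponding to a state of `A* ⊗ B`. -/
def processOf {A B : 𝒞} (s : 𝟙_ 𝒞 ⟶ (ᘁA) ⊗ B) : A ⟶ B :=
  (ρ_ A).inv ≫ A ◁ s ≫ (α_ A (ᘁA) B).inv ≫ cap A ▷ B ≫ (λ_ B).hom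

/-- Bending the input wire `C` of a process upwards. -/
def bendInput {C Z D : 𝒞} (f : C ⊗ Z ⟶ D) : Z ⟶ (ᘁC) ⊗ D :=
  (λ_ Z).inv ≫ cup C ▷ Z ≫ (α_ (ᘁC) C Z).hom ≫ (ᘁC) ◁ f

/-- The effect on `A ⊗ B*` corresponding to a process `A ⟶ B`. -/
def effectOf {A B : 𝒞} (f : A ⟶ B) : A ⊗ (ᘁB) ⟶ 𝟙_ 𝒞 := f ▷ (ᘁB) ≫ cap B

variable (disc : ∀ A : 𝒞, A ⟶ 𝟙_ 𝒞)

/-- A process is causal if discarding its output amounts to discarding its input. -/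
def IsCausal {A B : 𝒞} (f : A ⟶ B) : Prop := f ≫ disc B = disc A

/-- The unnormalised uniform state of `A`, the transpose of discarding. -/
def uniformState (A : 𝒞) : 𝟙_ 𝒞 ⟶ A := cup A ≫ disc (ᘁA) ▷ A ≫ (λ_ A).hom

/-- The dimension `d_A`: the uniform state of `A`, discarded. -/
def dimension (A : 𝒞) : 𝟙_ 𝒞 ⟶ 𝟙_ 𝒞 := uniformState disc A ≫ disc A

/-- The uniform state of `B*`: discarding on `B`, bent into a state. -/
def discState (B : 𝒞) : 𝟙_ 𝒞 ⟶ (ᘁB) := stateOf (disc B) ≫ (ρ_ (ᘁB)).hom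

/-- The closed loop of a system, i.e. its dimension as an object of a compact closed category. -/
def loop (A : 𝒞) : 𝟙_ 𝒞 ⟶ 𝟙_ 𝒞 := cup A ≫ (β_ (ᘁA) A).hom ≫ cap A

/-- A comb `w : A* ⊗ B ⊗ C* ⊗ D`, which maps processes `B ⟶ C` to processes `A ⟶ D`, applied to
a process `B ⟶ C`. -/
def plug {A B C D : 𝒞} (w : 𝟙_ 𝒞 ⟶ (ᘁA) ⊗ (B ⊗ ((ᘁC) ⊗ D))) (f : B ⟶ C) : A ⟶ D :=
  processOf (w ≫ (ᘁA) ◁ ((α_ B (ᘁC) D).inv ≫ effectOf f ▷ D ≫ (λ_ D).hom))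

/-- The comb `w : A* ⊗ B ⊗ C* ⊗ D` built from a first process `A ⟶ B ⊗ Z`, a hole of type
`B ⟶ C`, a memory wire `Z` and a second process `C ⊗ Z ⟶ D`. -/
def combOf {A B C D Z : 𝒞} (f₁ : A ⟶ B ⊗ Z) (f₂ : C ⊗ Z ⟶ D) :
    𝟙_ 𝒞 ⟶ (ᘁA) ⊗ (B ⊗ ((ᘁC) ⊗ D)) :=
  stateOf (f₁ ≫ B ◁ bendInput f₂)

/-- A comb is second-order causal if it sends causal processes to causal processes. -/
def IsSecondOrderCausal {A B C D : 𝒞} (w : 𝟙_ 𝒞 ⟶ (ᘁA) ⊗ (B ⊗ ((ᘁC) ⊗ D))) : Prop :=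
  ∀ f : B ⟶ C, IsCausal disc f → IsCausal disc (plug w f)

/-- `Φ : A ⊗ B ⟶ A' ⊗ B'` is semicausal (one-way signalling, `A` before `B`): discarding `B'`
gives a causal process `A ⟶ A'` next to discarding `B`. -/
def IsSemicausal {A B A' B' : 𝒞} (Φ : A ⊗ B ⟶ A' ⊗ B') : Prop :=
  ∃ Φ' : A ⟶ A', IsCausal disc Φ' ∧ Φ ≫ A' ◁ disc B' = Φ' ⊗ₘ disc B

/-- `Φ : A ⊗ B ⟶ A' ⊗ B'` is semilocalizable: it is a causal process on Alice's side followed by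
a causal process on Bob's side, with a wire `Z` from the first to the second. -/
def IsSemilocalizable {A B A' B' : 𝒞} (Φ : A ⊗ B ⟶ A' ⊗ B') : Prop :=
  ∃ (Z : 𝒞) (Φ₁ : A ⟶ A' ⊗ Z) (Φ₂ : Z ⊗ B ⟶ B'), IsCausal disc Φ₁ ∧ IsCausal disc Φ₂ ∧
    Φ = Φ₁ ▷ B ≫ (α_ A' Z B).hom ≫ A' ◁ Φ₂

/-- (C1) Discarding is compatible with the monoidal structure. -/
def AxiomC1 : Prop :=
  (∀ A B : 𝒞, disc (A ⊗ B) = (disc A ⊗ₘ disc B) ≫ (λ_ (𝟙_ 𝒞)).hom) ∧ disc (𝟙_ 𝒞) = 𝟙 (𝟙_ 𝒞)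

/-- (C2) The dimension of every non-zero system is an invertible scalar. -/
def AxiomC2 : Prop := ∀ A : 𝒞, ¬ Limits.IsZero A → IsIso (dimension disc A)

/-- (C3) Enough causal states. -/
def AxiomC3 : Prop :=
  ∀ (A B : 𝒞) (f g : A ⟶ B),
    (∀ ρ : 𝟙_ 𝒞 ⟶ A, IsCausal disc ρ → ρ ≫ f = ρ ≫ g) → f = g

/-- (C4) Second-order causal processes factorise. -/
def AxiomC4 : Prop :=
  ∀ (A B C D : 𝒞) (w : 𝟙_ 𝒞 ⟶ (ᘁA) ⊗ (B ⊗ ((ᘁC) ⊗ D))), IsSecondOrderCausal disc w →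
    ∃ (Z : 𝒞) (Φ₁ : A ⟶ B ⊗ Z) (Φ₂ : C ⊗ Z ⟶ D), IsCausal disc Φ₁ ∧ IsCausal disc Φ₂ ∧
      w = combOf Φ₁ Φ₂

/-- (C4') One-way signalling causal processes factorise. -/
def AxiomC4' : Prop :=
  ∀ (A B A' B' : 𝒞) (Φ : A ⊗ B ⟶ A' ⊗ B'), IsSemicausal disc Φ → IsSemilocalizable disc Φ

/-- (C5') A state `w` of `A ⊗ B*` (an effect on processes `A ⟶ B`) that takes the value `1` on
all causal processes is a causal state of `A` next to discarding on `B`. -/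
def AxiomC5' : Prop :=
  ∀ (A B : 𝒞) (w : 𝟙_ 𝒞 ⟶ A ⊗ (ᘁB)),
    (∀ Φ : A ⟶ B, IsCausal disc Φ → w ≫ effectOf Φ = 𝟙 (𝟙_ 𝒞)) →
    ∃ ρ : 𝟙_ 𝒞 ⟶ A, IsCausal disc ρ ∧ w = (λ_ (𝟙_ 𝒞)).inv ≫ (ρ ⊗ₘ discState disc B)

/-- A compact closed category with discarding processes `disc` is precausal. -/
structure IsPrecausal : Prop where
  c1 : AxiomC1 disc
  c2 : AxiomC2 disc
  c3 : AxiomC3 disc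
  c4 : AxiomC4 disc

end Precausal

/-! ## Completely positive maps between matrix algebras -/

/-- An object of the category of completely positive maps: the matrix algebra
`L(H) = Matrix ι ℂ` on the Hilbert space `H = ℂ^ι` with basis indexed by a finite type `ι`. -/
structure CPM : Type 1 where
  of ::
  /-- The index type of the basis. -/
  idx : Type
  [fintype : Fintype idx]
  [decEq : DecidableEq idx]

namespace CPM

attribute [instance] CPM.fintype CPM.decEq

/-- The matrix algebra of an object. -/
abbrev Alg (A : CPM) : Type := Matrix A.idx A.idx ℂ

section Linear

variable {k l m n p : Type}

/-- `id_k ⊗ Φ`. -/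
def lTensor (k : Type) (Φ : Matrix m m ℂ →ₗ[ℂ] Matrix n n ℂ) :
    Matrix (k × m) (k × m) ℂ →ₗ[ℂ] Matrix (k × n) (k × n) ℂ where
  toFun M := Matrix.of fun x y => Φ (Matrix.of fun i j => M (x.1, i) (y.1, j)) x.2 y.2
  map_add' M N := by
    ext x y
    exact congrFun (congrFun (Φ.map_add (Matrix.of fun i j => M (x.1, i) (y.1, j))
      (Matrix.of fun i j => N (x.1, i) (y.1, j))) x.2) y.2
  map_smul' c M := by
    ext x y
    exact congrFun (congrFun (Φ.map_smul c (Matrix.of fun i j => M (x.1, i) (y.1, j))) x.2) y.2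

/-- `Φ ⊗ id_k`. -/
def rTensor (k : Type) (Φ : Matrix m m ℂ →ₗ[ℂ] Matrix n n ℂ) :
    Matrix (m × k) (m × k) ℂ →ₗ[ℂ] Matrix (n × k) (n × k) ℂ where
  toFun M := Matrix.of fun x y => Φ (Matrix.of fun i j => M (i, x.2) (j, y.2)) x.1 y.1
  map_add' M N := by
    ext x y
    exact congrFun (congrFun (Φ.map_add (Matrix.of fun i j => M (i, x.2) (j, y.2))
      (Matrix.of fun i j => N (i, x.2) (j, y.2))) x.1) y.1
  map_smul' c M := by
    ext x y
    exact congrFun (congrFun (Φ.map_smul c (Matrix.of fun i j => M (i, x.2) (j, y.2))) x.1) y.1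

theorem lTensor_kronecker (Φ : Matrix m m ℂ →ₗ[ℂ] Matrix n n ℂ) (a : Matrix k k ℂ)
    (b : Matrix m m ℂ) : lTensor k Φ (a ⊗ₖ b) = a ⊗ₖ Φ b := by
  ext x y
  exact congrFun (congrFun (Φ.map_smul (a x.1 y.1) b) x.2) y.2

theorem rTensor_kronecker (Φ : Matrix m m ℂ →ₗ[ℂ] Matrix n n ℂ) (a : Matrix m m ℂ)
    (b : Matrix k k ℂ) : rTensor k Φ (a ⊗ₖ b) = Φ a ⊗ₖ b := by
  ext x y
  have h : (Matrix.of fun i j => (a ⊗ₖ b) (i, x.2) (j, y.2)) = b x.2 y.2 • a := by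
    ext i j; simp [Matrix.kroneckerMap_apply, mul_comm]
  change Φ (Matrix.of fun i j => (a ⊗ₖ b) (i, x.2) (j, y.2)) x.1 y.1 = _
  rw [h, Φ.map_smul]
  simp [Matrix.kroneckerMap_apply, mul_comm]

/-- Linear maps on a tensor product of matrix algebras are determined on product matrices. -/
theorem ext_kronecker [Fintype k] [Fintype m] [DecidableEq k] [DecidableEq m] {V : Type*}
    [AddCommMonoid V] [Module ℂ V] {f g : Matrix (k × m) (k × m) ℂ →ₗ[ℂ] V}
    (h : ∀ a b, f (a ⊗ₖ b) = g (a ⊗ₖ b)) : f = g := by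
  refine Matrix.ext_linearMap _ fun x y => LinearMap.ext_ring ?_
  have := h (Matrix.single x.1 y.1 1) (Matrix.single x.2 y.2 1)
  rw [Matrix.single_kronecker_single, mul_one] at this
  exact this

/-- Complete positivity: `id_k ⊗ Φ` preserves positive semidefinite matrices for every `k`. -/
def IsCP (Φ : Matrix m m ℂ →ₗ[ℂ] Matrix n n ℂ) : Prop :=
  ∀ (k : ℕ) (M : Matrix (Fin k × m) (Fin k × m) ℂ), M.PosSemidef →
    (lTensor (Fin k) Φ M).PosSemidef

theorem IsCP.lTensor_posSemidef [Fintype k] {Φ : Matrix m m ℂ →ₗ[ℂ] Matrix n n ℂ} (h : IsCP Φ)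
    {M : Matrix (k × m) (k × m) ℂ} (hM : M.PosSemidef) : (lTensor k Φ M).PosSemidef := by
  let e := Fintype.equivFin k
  have := (h _ _ (hM.submatrix (Prod.map e.symm id))).submatrix (Prod.map e id)
  convert this using 1
  ext x y
  simp [lTensor]

theorem IsCP.lTensor [Fintype k] {Φ : Matrix m m ℂ →ₗ[ℂ] Matrix n n ℂ} (h : IsCP Φ) :
    IsCP (lTensor k Φ) := fun l _ hM =>
  (h.lTensor_posSemidef (k := Fin l × k) (hM.submatrix (Equiv.prodAssoc _ _ _))).submatrix
    (Equiv.prodAssoc _ _ _).symm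

theorem IsCP.comp {Φ : Matrix m m ℂ →ₗ[ℂ] Matrix n n ℂ} {Ψ : Matrix n n ℂ →ₗ[ℂ] Matrix p p ℂ}
    (hΨ : IsCP Ψ) (hΦ : IsCP Φ) : IsCP (Ψ ∘ₗ Φ) := fun k M hM => hΨ k _ (hΦ k M hM)

theorem isCP_id : IsCP (LinearMap.id : Matrix m m ℂ →ₗ[ℂ] Matrix m m ℂ) := fun _ _ hM => hM

/-- Relabelling of the basis along a bijection. -/
def relabel (e : m ≃ n) : Matrix m m ℂ →ₗ[ℂ] Matrix n n ℂ :=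
  (Matrix.reindexLinearEquiv ℂ ℂ e e).toLinearMap

theorem isCP_relabel (e : m ≃ n) : IsCP (relabel e) := fun k _ hM =>
  hM.submatrix (Prod.map (id : Fin k → Fin k) e.symm)

theorem rTensor_eq (Φ : Matrix m m ℂ →ₗ[ℂ] Matrix n n ℂ) :
    rTensor k Φ = relabel (Equiv.prodComm k n) ∘ₗ lTensor k Φ ∘ₗ relabel (Equiv.prodComm m k) :=
  rfl

theorem IsCP.rTensor [Fintype k] {Φ : Matrix m m ℂ →ₗ[ℂ] Matrix n n ℂ} (h : IsCP Φ) :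
    IsCP (rTensor k Φ) := by
  rw [rTensor_eq]
  exact (isCP_relabel _).comp (h.lTensor.comp (isCP_relabel _))

theorem isCP_conj [Fintype m] [Fintype n] (V : Matrix n m ℂ)
    (Φ : Matrix m m ℂ →ₗ[ℂ] Matrix n n ℂ) (h : ∀ M, Φ M = V * M * Vᴴ) : IsCP Φ := by
  intro k M hM
  have := hM.mul_mul_conjTranspose_same ((1 : Matrix (Fin k) (Fin k) ℂ) ⊗ₖ V)
  convert this using 1
  ext x y
  simp only [CPM.lTensor, h, LinearMap.coe_mk, AddHom.coe_mk, Matrix.of_apply, Matrix.mul_apply,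
    Fintype.sum_prod_type, Matrix.conjTranspose_apply, Matrix.kroneckerMap_apply, Matrix.one_apply]
  simp [apply_ite (starRingEnd ℂ)]

theorem IsCP.sum {ι : Type} (s : Finset ι) (Φ : ι → Matrix m m ℂ →ₗ[ℂ] Matrix n n ℂ)
    (h : ∀ i, IsCP (Φ i)) : IsCP (∑ i ∈ s, Φ i) := by
  intro k M hM
  have := Matrix.posSemidef_sum s fun i _ => h i k M hM
  convert this using 1
  ext x y
  simp [CPM.lTensor, Matrix.sum_apply]

end Linear

/-- A morphism is a completely positive linear map. -/
@[ext]
structure Hom (A B : CPM) where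
  /-- The underlying linear map. -/
  lin : A.Alg →ₗ[ℂ] B.Alg
  isCP : IsCP lin

instance : Category CPM where
  Hom := Hom
  id A := ⟨LinearMap.id, isCP_id⟩
  comp f g := ⟨g.lin ∘ₗ f.lin, g.isCP.comp f.isCP⟩

@[simp] theorem lin_id (A : CPM) : Hom.lin (𝟙 A) = LinearMap.id := rfl

@[simp] theorem lin_comp {A B D : CPM} (f : A ⟶ B) (g : B ⟶ D) :
    Hom.lin (f ≫ g) = Hom.lin g ∘ₗ Hom.lin f := rfl

theorem hom_ext {A B : CPM} {f g : A ⟶ B} (h : Hom.lin f = Hom.lin g) : f = g := Hom.ext h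

/-- The isomorphism given by relabelling the basis. -/
def relabelIso {A B : CPM} (e : A.idx ≃ B.idx) : A ≅ B where
  hom := ⟨relabel e, isCP_relabel e⟩
  inv := ⟨relabel e.symm, isCP_relabel e.symm⟩
  hom_inv_id := by apply hom_ext; ext; simp [relabel]
  inv_hom_id := by apply hom_ext; ext; simp [relabel]

/-- `L(H) ⊗ L(K) = L(H ⊗ K)`, `I = L(ℂ)`, and `Φ ⊗ Ψ` is determined by
`(Φ ⊗ Ψ) (a ⊗ b) = Φ a ⊗ Ψ b`. -/
instance : MonoidalCategoryStruct CPM where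
  tensorObj A B := .of (A.idx × B.idx)
  tensorUnit := .of Unit
  whiskerLeft A _ _ f := ⟨lTensor A.idx f.lin, f.isCP.lTensor⟩
  whiskerRight f B := ⟨rTensor B.idx f.lin, f.isCP.rTensor⟩
  tensorHom {_ B A' _} f g :=
    ⟨lTensor B.idx g.lin ∘ₗ rTensor A'.idx f.lin, g.isCP.lTensor.comp f.isCP.rTensor⟩
  associator A B D := relabelIso (Equiv.prodAssoc A.idx B.idx D.idx)
  leftUnitor A := relabelIso (Equiv.punitProd A.idx)
  rightUnitor A := relabelIso (Equiv.prodPUnit A.idx)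

/-- The Kronecker product `a ⊗ b` as an element of `L(H ⊗ K)`. -/
def kr {A B : CPM} (a : A.Alg) (b : B.Alg) : (A ⊗ B).Alg := a ⊗ₖ b

theorem smul_kr {A B : CPM} (c : ℂ) (a : A.Alg) (b : B.Alg) : kr (c • a) b = c • kr a b :=
  Matrix.smul_kronecker _ _ _

theorem kr_smul {A B : CPM} (c : ℂ) (a : A.Alg) (b : B.Alg) : kr a (c • b) = c • kr a b :=
  Matrix.kronecker_smul _ _ _

/-- `a ↦ a ⊗ b` as a linear map. -/
def krLin {A B : CPM} (b : B.Alg) : A.Alg →ₗ[ℂ] (A ⊗ B).Alg where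
  toFun a := kr a b
  map_add' x y := Matrix.add_kronecker x y b
  map_smul' c x := smul_kr c x b

/-- The defining property of the tensor product of completely positive maps. -/
theorem tensorHom_kr {A B A' B' : CPM} (f : A ⟶ A') (g : B ⟶ B') (a : A.Alg) (b : B.Alg) :
    Hom.lin (f ⊗ₘ g) (kr a b) = kr (Hom.lin f a) (Hom.lin g b) := by
  change lTensor _ _ (rTensor _ _ (a ⊗ₖ b)) = _
  rw [rTensor_kronecker, lTensor_kronecker]
  rfl

theorem whiskerLeft_kr (A : CPM) {B B' : CPM} (g : B ⟶ B') (a : A.Alg) (b : B.Alg) :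
    Hom.lin (A ◁ g) (kr a b) = kr a (Hom.lin g b) := lTensor_kronecker _ _ _

theorem whiskerRight_kr {A A' : CPM} (f : A ⟶ A') (B : CPM) (a : A.Alg) (b : B.Alg) :
    Hom.lin (f ▷ B) (kr a b) = kr (Hom.lin f a) b := rTensor_kronecker _ _ _

theorem associator_kr (A B D : CPM) (a : A.Alg) (b : B.Alg) (d : D.Alg) :
    Hom.lin (α_ A B D).hom (kr (kr a b) d) = kr a (kr b d) := by
  ext x y
  exact mul_assoc _ _ _

theorem associator_inv_kr (A B D : CPM) (a : A.Alg) (b : B.Alg) (d : D.Alg) :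
    Hom.lin (α_ A B D).inv (kr a (kr b d)) = kr (kr a b) d := by
  ext x y
  exact (mul_assoc _ _ _).symm

theorem leftUnitor_kr (A : CPM) (c : (𝟙_ CPM).Alg) (a : A.Alg) :
    Hom.lin (λ_ A).hom (kr c a) = c () () • a := rfl

theorem rightUnitor_kr (A : CPM) (c : (𝟙_ CPM).Alg) (a : A.Alg) :
    Hom.lin (ρ_ A).hom (kr a c) = c () () • a := by
  ext x y
  exact mul_comm _ _

theorem hom_ext₂ {A B D : CPM} {f g : A ⊗ B ⟶ D}
    (h : ∀ (a : A.Alg) (b : B.Alg), Hom.lin f (kr a b) = Hom.lin g (kr a b)) : f = g :=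
  hom_ext (ext_kronecker h)

theorem hom_ext₃ {A B D E : CPM} {f g : (A ⊗ B) ⊗ D ⟶ E}
    (h : ∀ (a : A.Alg) (b : B.Alg) (d : D.Alg),
      Hom.lin f (kr (kr a b) d) = Hom.lin g (kr (kr a b) d)) : f = g := by
  refine hom_ext₂ fun x d => ?_
  have : Hom.lin f ∘ₗ krLin d = Hom.lin g ∘ₗ krLin d := ext_kronecker fun a b => h a b d
  exact LinearMap.congr_fun this x

theorem hom_ext₄ {A B D E F : CPM} {f g : ((A ⊗ B) ⊗ D) ⊗ E ⟶ F}
    (h : ∀ (a : A.Alg) (b : B.Alg) (d : D.Alg) (e : E.Alg),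
      Hom.lin f (kr (kr (kr a b) d) e) = Hom.lin g (kr (kr (kr a b) d) e)) : f = g := by
  refine hom_ext₃ fun x d e => ?_
  have : Hom.lin f ∘ₗ krLin e ∘ₗ krLin d = Hom.lin g ∘ₗ krLin e ∘ₗ krLin d :=
    ext_kronecker fun a b => h a b d e
  exact LinearMap.congr_fun this x

instance : MonoidalCategory CPM := MonoidalCategory.ofTensorHom
  (id_tensorHom_id := fun _ _ => hom_ext₂ fun a b => by simp [tensorHom_kr])
  (tensorHom_comp_tensorHom := fun _ _ _ _ => hom_ext₂ fun a b => by simp [tensorHom_kr])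
  (id_tensorHom := fun _ _ _ _ => hom_ext₂ fun a b => by
    simp [tensorHom_kr, whiskerLeft_kr])
  (tensorHom_id := fun _ _ => hom_ext₂ fun a b => by
    simp [tensorHom_kr, whiskerRight_kr])
  (pentagon := fun _ _ _ _ => hom_ext₄ fun a b c d => by
    simp [associator_kr, tensorHom_kr])
  (triangle := fun _ _ => hom_ext₃ fun a b c => by
    simp [associator_kr, tensorHom_kr, leftUnitor_kr, rightUnitor_kr, smul_kr, kr_smul])
  (associator_naturality := fun _ _ _ => hom_ext₃ fun a b c => by
    simp [associator_kr, tensorHom_kr])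
  (leftUnitor_naturality := fun _ => hom_ext₂ fun a b => by
    simp [tensorHom_kr, leftUnitor_kr])
  (rightUnitor_naturality := fun _ => hom_ext₂ fun a b => by
    simp [tensorHom_kr, rightUnitor_kr])

/-- The swap. -/
def swap (A B : CPM) : A ⊗ B ≅ B ⊗ A := relabelIso (Equiv.prodComm A.idx B.idx)

theorem swap_kr (A B : CPM) (a : A.Alg) (b : B.Alg) :
    Hom.lin (swap A B).hom (kr a b) = kr b a := by
  ext x y
  exact mul_comm _ _

instance : SymmetricCategory CPM where
  braiding := swap
  braiding_naturality_right _ _ _ _ := hom_ext₂ fun a b => by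
    simp [swap_kr, whiskerLeft_kr, whiskerRight_kr]
  braiding_naturality_left _ _ := hom_ext₂ fun a b => by
    simp [swap_kr, whiskerLeft_kr, whiskerRight_kr]
  hexagon_forward _ _ _ := hom_ext₃ fun a b c => by
    simp [swap_kr, whiskerLeft_kr, whiskerRight_kr, associator_kr]
  hexagon_reverse _ _ _ := by
    rw [← cancel_epi (α_ _ _ _).hom]
    refine hom_ext₃ fun a b c => ?_
    simp [swap_kr, whiskerLeft_kr, whiskerRight_kr, associator_kr, associator_inv_kr]
  symmetry _ _ := hom_ext₂ fun a b => by simp [swap_kr]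

/-- The cup `I ⟶ A ⊗ A`, the operator `|Φ₀⟩⟨Φ₀|` with `|Φ₀⟩ = ∑ i, |i⟩ ⊗ |i⟩`. -/
def bellState (A : CPM) : 𝟙_ CPM ⟶ A ⊗ A where
  lin :=
    { toFun := fun c => Matrix.of fun x y : A.idx × A.idx =>
        if x.1 = x.2 ∧ y.1 = y.2 then c () () else 0
      map_add' := fun c d => by ext x y; by_cases h : x.1 = x.2 ∧ y.1 = y.2 <;> simp [h]
      map_smul' := fun r c => by ext x y; by_cases h : x.1 = x.2 ∧ y.1 = y.2 <;> simp [h] }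
  isCP := by
    refine isCP_conj (Matrix.of fun (x : A.idx × A.idx) (_ : Unit) => if x.1 = x.2 then 1 else 0)
      _ fun M => ?_
    ext x y
    by_cases h : x.1 = x.2 <;> by_cases h' : y.1 = y.2 <;> simp [Matrix.mul_apply, h, h']

/-- The cap `A ⊗ A ⟶ I`, the effect `⟨Φ₀| a |Φ₀⟩`. -/
def bellEffect (A : CPM) : A ⊗ A ⟶ 𝟙_ CPM where
  lin :=
    { toFun := fun a => Matrix.of fun _ _ => ∑ i : A.idx, ∑ j : A.idx, a (i, i) (j, j)
      map_add' := fun a b => by ext; simp [Finset.sum_add_distrib]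
      map_smul' := fun r a => by ext; simp [Finset.mul_sum] }
  isCP := by
    refine isCP_conj (Matrix.of fun (_ : Unit) (x : A.idx × A.idx) => if x.1 = x.2 then 1 else 0)
      _ fun M => ?_
    ext x y
    simp only [Matrix.mul_apply, Matrix.conjTranspose_apply]
    rw [Fintype.sum_prod_type]
    simp only [Fintype.sum_prod_type, Matrix.of_apply, ite_mul, one_mul, zero_mul,
      Finset.sum_ite_eq, Finset.mem_univ, if_true, LinearMap.coe_mk, AddHom.coe_mk]
    rw [Finset.sum_comm]
    simp [apply_ite (starRingEnd ℂ)]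

/-- The category is compact closed, every object being its own dual. -/
instance : LeftRigidCategory CPM where
  leftDual A :=
    { leftDual := A
      exact :=
        { coevaluation' := bellState A
          evaluation' := bellEffect A
          coevaluation_evaluation' := by
            refine hom_ext (LinearMap.ext fun M => Matrix.ext fun x y => ?_)
            change (∑ i : A.idx, ∑ j : A.idx, if i = x.2 ∧ j = y.2 then
              M (i, ()) (j, ()) else 0) = M (x.2, ()) (y.2, ())
            simp [ite_and]
          evaluation_coevaluation' := by
            refine hom_ext (LinearMap.ext fun M => Matrix.ext fun x y => ?_)
            change (∑ i : A.idx, ∑ j : A.idx, if x.1 = i ∧ y.1 = j then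
              M ((), i) ((), j) else 0) = M ((), x.1) ((), y.1)
            simp [ite_and] } }

/-- The compression of `a` to the `i`-th diagonal entry. -/
def diagEntry (A : CPM) (i : A.idx) : A.Alg →ₗ[ℂ] (𝟙_ CPM).Alg where
  toFun a := Matrix.of fun _ _ => a i i
  map_add' _ _ := rfl
  map_smul' _ _ := rfl

theorem isCP_diagEntry (A : CPM) (i : A.idx) : IsCP (diagEntry A i) := by
  refine isCP_conj (Matrix.of fun (_ : Unit) (x : A.idx) => if x = i then 1 else 0) _ fun M => ?_
  ext x y
  simp only [Matrix.mul_apply, Matrix.conjTranspose_apply, Matrix.of_apply]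
  simp [apply_ite (starRingEnd ℂ)]
  rfl

/-- Discarding is the trace. -/
def discard (A : CPM) : A ⟶ 𝟙_ CPM where
  lin :=
    { toFun := fun a => Matrix.of fun _ _ => a.trace
      map_add' := fun a b => by ext; simp
      map_smul' := fun r a => by ext; simp }
  isCP := by
    convert IsCP.sum Finset.univ (diagEntry A) (isCP_diagEntry A) using 1
    ext x y
    simp only [LinearMap.sum_apply, Matrix.sum_apply, LinearMap.coe_mk,
      AddHom.coe_mk, Matrix.of_apply]
    rfl

end CPM

/-! Everything is read off Choi matrices. A completely positive map is the same as a positive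
semidefinite matrix on input ⊗ output, causality says that tracing out the output leaves the
identity, and plugging or composing is contraction of indices. (C3) then holds because density
matrices span.

For (C4) and (C5'), a linear functional constant on Choi matrices of causal maps B → C sees C only
through the trace (`functional_causal`): compare maps that test an effect E and prepare one state if
E occurs and a fixed state otherwise. Dually, a matrix with constant pairing is a matrix on B
tensored with the identity on C (`pairing_causal`). This proves (C5'). In (C4) it shows that tracing
D out of w leaves u ⊗ 1 on C, with u the Choi matrix of a causal map A → B. In (C4') the hypothesis
gives such a marginal directly.

Both factorizations then follow from one construction (`exists_memory`, `exists_realization`). Write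
u = V Vᴴ on its support Z. Then V is a pure causal map A → B ⊗ Z, and compressing w by a left
inverse of V gives the Choi matrix of the second causal map. Nothing is lost, since positivity
confines w to the support of u. -/

namespace CPM

/-! ### Positive semidefinite matrices, partial traces and pairings -/

section LinearAlgebra

variable {k l m n p : Type}

/-- Polarization: positive semidefinite matrices span all matrices. -/
theorem ext_posSemidef [Fintype m] [DecidableEq m] {V : Type*} [AddCommGroup V] [Module ℂ V]
    {f g : Matrix m m ℂ →ₗ[ℂ] V} (h : ∀ M : Matrix m m ℂ, M.PosSemidef → f M = g M) : f = g := by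
  refine LinearMap.ext fun M => ?_
  -- For c = ±1, ±i, the c-weighted sum of (M + c)(M + c)ᴴ cancels every term except 4M.
  have key : M = (1 / 4 : ℂ) • ((M + 1) * (M + 1)ᴴ - (M - 1) * (M - 1)ᴴ
      + Complex.I • ((M + Complex.I • 1) * (M + Complex.I • 1)ᴴ)
      - Complex.I • ((M - Complex.I • 1) * (M - Complex.I • 1)ᴴ)) := by
    simp only [Matrix.conjTranspose_add, Matrix.conjTranspose_sub, Matrix.conjTranspose_smul,
      Matrix.conjTranspose_one, add_mul, mul_add, sub_mul, mul_sub, smul_mul_assoc,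
      mul_smul_comm, mul_one, one_mul, Complex.star_def, Complex.conj_I]
    ext i j
    simp only [Matrix.smul_apply, Matrix.sub_apply, Matrix.add_apply, smul_eq_mul]
    ring_nf
    simp only [Complex.I_sq]
    ring
  have hp : ∀ N : Matrix m m ℂ, f (N * Nᴴ) = g (N * Nᴴ) := fun N =>
    h _ (Matrix.posSemidef_self_mul_conjTranspose N)
  rw [key]
  simp only [map_smul, map_sub, map_add, hp]

/-- Density matrices span all matrices. -/
theorem ext_density [Fintype m] [DecidableEq m] {V : Type*} [AddCommGroup V] [Module ℂ V]
    {f g : Matrix m m ℂ →ₗ[ℂ] V}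
    (h : ∀ M : Matrix m m ℂ, M.PosSemidef → M.trace = 1 → f M = g M) : f = g := by
  refine ext_posSemidef fun M hM => ?_
  by_cases h0 : M.trace = 0
  · rw [hM.trace_eq_zero_iff.1 h0, map_zero, map_zero]
  · have h1 := h (M.trace⁻¹ • M) (hM.smul (inv_nonneg.2 hM.trace_nonneg))
      (by rw [Matrix.trace_smul, smul_eq_mul, inv_mul_cancel₀ h0])
    rw [map_smul, map_smul] at h1
    exact smul_right_injective V (inv_ne_zero h0) h1

/-- The spectral theorem for positive semidefinite matrices. -/
theorem exists_spectral [Fintype m] [DecidableEq m] {M : Matrix m m ℂ} (hM : M.PosSemidef) :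
    ∃ (U : Matrix m m ℂ) (d : m → ℝ), U * Uᴴ = 1 ∧ Uᴴ * U = 1 ∧ (∀ i, 0 ≤ d i) ∧
      M = U * Matrix.diagonal (fun i => (d i : ℂ)) * Uᴴ ∧ M.trace = (∑ i, d i : ℝ) := by
  refine ⟨hM.isHermitian.eigenvectorUnitary.1, hM.isHermitian.eigenvalues,
    Unitary.mul_star_self_of_mem hM.isHermitian.eigenvectorUnitary.2,
    Unitary.star_mul_self_of_mem hM.isHermitian.eigenvectorUnitary.2, hM.eigenvalues_nonneg,
    hM.isHermitian.spectral_theorem, ?_⟩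
  rw [hM.isHermitian.trace_eq_sum_eigenvalues]
  simp

/-- Density matrices are effects. -/
theorem posSemidef_one_sub [Fintype m] [DecidableEq m] {M : Matrix m m ℂ} (hM : M.PosSemidef)
    (ht : M.trace = 1) : (1 - M).PosSemidef := by
  obtain ⟨U, d, hU, -, hd, h, htr⟩ := exists_spectral hM
  -- The eigenvalues are nonnegative with sum 1, so none exceeds 1.
  have hle : ∀ i, d i ≤ 1 := by
    intro i
    have h1 : (∑ i, d i) = 1 := by
      rw [ht] at htr
      exact_mod_cast htr.symm
    rw [← h1]
    exact Finset.single_le_sum (fun j _ => hd j) (Finset.mem_univ i)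
  have h2 : (1 - M) = U * Matrix.diagonal (fun i => (1 : ℂ) - (d i : ℂ)) * Uᴴ := by
    rw [← Matrix.diagonal_sub, mul_sub, sub_mul, ← h, Matrix.diagonal_one, mul_one, hU]
  rw [h2]
  refine Matrix.PosSemidef.mul_mul_conjTranspose_same (Matrix.PosSemidef.diagonal fun i => ?_) U
  have := hle i
  simp only [Pi.zero_apply, sub_nonneg]
  exact_mod_cast this

/-- A positive semidefinite matrix factors through its support. -/
theorem exists_support_factor [Fintype m] [DecidableEq m] {u : Matrix m m ℂ} (hu : u.PosSemidef) :
    ∃ (Z : CPM) (V : Matrix m Z.idx ℂ) (L : Matrix Z.idx m ℂ), V * Vᴴ = u ∧ L * V = 1 := by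
  obtain ⟨U, d, -, hU, hd, h, -⟩ := exists_spectral hu
  -- Keep only eigenvectors with nonzero eigenvalue, scaled by √d. The scaling is then invertible,
  -- which gives the left inverse.
  refine ⟨.of {i // d i ≠ 0}, Matrix.of fun i z => U i z * (√(d z) : ℂ),
    Matrix.of fun z i => (√(d z) : ℂ)⁻¹ * Uᴴ z i, ?_, ?_⟩
  · rw [h]
    ext i j
    have hz : ∀ z : m, U i z * (√(d z) : ℂ) * star (U j z * (√(d z) : ℂ))
        = U i z * (d z : ℂ) * star (U j z) := by
      intro z
      have : ((√(d z) : ℝ) : ℂ) * (√(d z) : ℝ) = d z := by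
        rw [← Complex.ofReal_mul, Real.mul_self_sqrt (hd z)]
      simp only [star_mul', Complex.star_def, Complex.conj_ofReal]
      rw [← this]
      ring
    rw [Matrix.mul_apply, Matrix.mul_apply]
    simp only [Matrix.conjTranspose_apply, Matrix.of_apply, Matrix.mul_diagonal, hz]
    rw [← Finset.sum_filter_of_ne (p := fun k => d k ≠ 0)]
    · exact (Finset.sum_subtype (p := fun k => d k ≠ 0) _ (by simp)
        fun z => U i z * (d z : ℂ) * star (U j z)).symm
    · intro k _ hk h0
      simp [h0] at hk
  · ext z z'
    have h1 := congrFun (congrFun hU z) z'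
    have hz : (√(d z) : ℂ) ≠ 0 := by
      exact_mod_cast (Real.sqrt_pos.2 (lt_of_le_of_ne (hd z) (Ne.symm z.2))).ne'
    simp only [Matrix.mul_apply] at h1
    simp only [Matrix.mul_apply, Matrix.of_apply]
    have : ∀ i, (√(d z) : ℂ)⁻¹ * Uᴴ z i * (U i z' * (√(d z') : ℂ))
      = (√(d z) : ℂ)⁻¹ * (√(d z') : ℂ) * (Uᴴ z i * U i z') := fun i => by ring
    simp only [this, ← Finset.mul_sum, h1]
    by_cases hzz : z = z'
    · subst hzz
      simp [hz]
    · simp [hzz, Subtype.coe_injective.ne hzz]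

/-- A matrix vanishes on one side as soon as its compression has vanishing trace. -/
theorem mul_eq_zero_of_trace [Fintype m] [Fintype n] [DecidableEq m] {w : Matrix m m ℂ}
    (hw : w.PosSemidef) (Q : Matrix n m ℂ) (h : (Q * w * Qᴴ).trace = 0) : Q * w = 0 := by
  -- With w = V Vᴴ the trace is the squared Hilbert–Schmidt norm of Q V.
  obtain ⟨Z, V, -, rfl, -⟩ := exists_support_factor hw
  have h1 : (Q * V) * (Q * V)ᴴ = Q * (V * Vᴴ) * Qᴴ := by
    simp [Matrix.mul_assoc]
  rw [← h1, Matrix.trace_mul_conjTranspose_self_eq_zero_iff] at h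
  rw [← Matrix.mul_assoc, h, Matrix.zero_mul]

theorem sub_kronecker (A B : Matrix l m ℂ) (M : Matrix n p ℂ) :
    (A - B) ⊗ₖ M = A ⊗ₖ M - B ⊗ₖ M := by
  ext x y
  simp [sub_mul]

/-- The partial trace over the last factor. -/
def ptrace [Fintype n] (w : Matrix (m × n) (m × n) ℂ) : Matrix m m ℂ :=
  Matrix.of fun x y => ∑ d, w (x, d) (y, d)

theorem ptrace_kronecker [Fintype n] (E : Matrix m m ℂ) (σ : Matrix n n ℂ) :
    ptrace (E ⊗ₖ σ) = σ.trace • E := by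
  ext x y
  simp [ptrace, Matrix.trace, Finset.mul_sum, mul_comm]

theorem posSemidef_ptrace [Fintype n] {w : Matrix (m × n) (m × n) ℂ} (hw : w.PosSemidef) :
    (ptrace w).PosSemidef := by
  have h := Matrix.posSemidef_sum Finset.univ fun d _ => hw.submatrix fun x : m => (x, d)
  convert h using 1
  ext x y
  simp [ptrace, Matrix.sum_apply]

theorem posSemidef_single [DecidableEq m] (i : m) :
    (Matrix.single i i (1 : ℂ)).PosSemidef := by
  rw [← Matrix.diagonal_single]
  refine Matrix.PosSemidef.diagonal fun j => ?_
  by_cases hj : j = i <;> simp [hj]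

/-- If tracing out `D` from a positive matrix on `X ⊗ C ⊗ D` gives `u ⊗ 1_C`, then the matrix
arises from a factorization `u = V Vᴴ` by applying to `C` and the purifying system `Z` an operator
`N` which traces out to the identity. -/
theorem exists_memory {X C D : Type} [Fintype X] [Fintype C] [Fintype D] [DecidableEq X]
    [DecidableEq C] [DecidableEq D] {w : Matrix ((X × C) × D) ((X × C) × D) ℂ}
    {u : Matrix X X ℂ} (hw : w.PosSemidef) (hu : u.PosSemidef)
    (h : ptrace w = u ⊗ₖ (1 : Matrix C C ℂ)) :
    ∃ (Z : CPM) (V : Matrix X Z.idx ℂ) (N : Matrix ((Z.idx × C) × D) ((Z.idx × C) × D) ℂ),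
      u = V * Vᴴ ∧ N.PosSemidef ∧ ptrace N = 1 ∧
      w = ((V ⊗ₖ (1 : Matrix C C ℂ)) ⊗ₖ (1 : Matrix D D ℂ)) * N *
        ((V ⊗ₖ (1 : Matrix C C ℂ)) ⊗ₖ (1 : Matrix D D ℂ))ᴴ := by
  obtain ⟨Z, V, L, hV, hL⟩ := exists_support_factor hu
  -- Conjugation by an operator trivial on D commutes with tracing out D.
  have hpt : ∀ {Y : Type} [Fintype Y] (T : Matrix Y X ℂ),
      ptrace (((T ⊗ₖ (1 : Matrix C C ℂ)) ⊗ₖ (1 : Matrix D D ℂ)) * w *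
        ((T ⊗ₖ (1 : Matrix C C ℂ)) ⊗ₖ (1 : Matrix D D ℂ))ᴴ) =
      (T ⊗ₖ (1 : Matrix C C ℂ)) * ptrace w * (T ⊗ₖ (1 : Matrix C C ℂ))ᴴ := by
    intro Y _ T
    generalize T ⊗ₖ (1 : Matrix C C ℂ) = S
    ext x y
    have hS : ∀ z e z' d, (S ⊗ₖ (1 : Matrix D D ℂ)) (z, e) (z', d) =
        if e = d then S z z' else 0 := by
      intro z e z' d
      simp [Matrix.kroneckerMap_apply, Matrix.one_apply]
    simp only [ptrace, Matrix.of_apply, Matrix.mul_apply, Matrix.conjTranspose_apply,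
      Fintype.sum_prod_type (α₂ := D), hS, ite_mul, zero_mul, Finset.sum_ite_eq,
      Finset.mem_univ, if_true, apply_ite star, star_zero, mul_ite, mul_zero]
    rw [Finset.sum_comm]
    refine Finset.sum_congr rfl fun j _ => ?_
    rw [← Finset.sum_mul, Finset.sum_comm]
    simp only [Finset.mul_sum]
  -- Since 1 - V L kills u, the compression of w by it has trace zero, and positivity makes it kill
  -- w itself.
  have hQ : (((1 - V * L) ⊗ₖ (1 : Matrix C C ℂ)) ⊗ₖ (1 : Matrix D D ℂ)) * w = 0 := by
    refine mul_eq_zero_of_trace hw _ ?_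
    have h1 : ∀ {Y : Type} [Fintype Y] (M : Matrix (Y × D) (Y × D) ℂ),
        M.trace = (ptrace M).trace := fun M => by
      simp [Matrix.trace, ptrace, Fintype.sum_prod_type]
    have h2 : (1 - V * L) * u = 0 := by
      rw [← hV, sub_mul, one_mul, Matrix.mul_assoc, ← Matrix.mul_assoc L, hL, Matrix.one_mul,
        sub_self]
    rw [h1, hpt, h, ← Matrix.mul_kronecker_mul, h2, Matrix.zero_kronecker, Matrix.zero_mul,
      Matrix.trace_zero]
  have hw' : (((V * L) ⊗ₖ (1 : Matrix C C ℂ)) ⊗ₖ (1 : Matrix D D ℂ)) * w = w := by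
    have h1 : ((1 - V * L) ⊗ₖ (1 : Matrix C C ℂ)) ⊗ₖ (1 : Matrix D D ℂ) =
        1 - ((V * L) ⊗ₖ (1 : Matrix C C ℂ)) ⊗ₖ (1 : Matrix D D ℂ) := by
      rw [sub_kronecker, sub_kronecker, Matrix.one_kronecker_one,
        Matrix.one_kronecker_one]
    rw [h1, Matrix.sub_mul, Matrix.one_mul, sub_eq_zero] at hQ
    exact hQ.symm
  have hw'' : w * (((V * L) ⊗ₖ (1 : Matrix C C ℂ)) ⊗ₖ (1 : Matrix D D ℂ))ᴴ = w := by
    have h1 := congrArg Matrix.conjTranspose hw'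
    rwa [Matrix.conjTranspose_mul, hw.isHermitian.eq] at h1
  -- N is w compressed by L. Its marginal is L u Lᴴ ⊗ 1 = (L V)(L V)ᴴ ⊗ 1 = 1, and conjugating back
  -- by V only applies V L on both sides, which fixes w.
  refine ⟨Z, V, ((L ⊗ₖ (1 : Matrix C C ℂ)) ⊗ₖ (1 : Matrix D D ℂ)) * w *
        ((L ⊗ₖ (1 : Matrix C C ℂ)) ⊗ₖ (1 : Matrix D D ℂ))ᴴ, hV.symm,
        hw.mul_mul_conjTranspose_same _, ?_, ?_⟩
  · rw [hpt, h, Matrix.conjTranspose_kronecker, ← Matrix.mul_kronecker_mul,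
      ← Matrix.mul_kronecker_mul, ← hV, ← Matrix.mul_assoc L, hL, Matrix.one_mul,
      ← Matrix.conjTranspose_mul, hL]
    simp
  · have h1 : ((V * L) ⊗ₖ (1 : Matrix C C ℂ)) ⊗ₖ (1 : Matrix D D ℂ) =
        ((V ⊗ₖ (1 : Matrix C C ℂ)) ⊗ₖ (1 : Matrix D D ℂ)) *
        ((L ⊗ₖ (1 : Matrix C C ℂ)) ⊗ₖ (1 : Matrix D D ℂ)) := by
      rw [← Matrix.mul_kronecker_mul, ← Matrix.mul_kronecker_mul, Matrix.one_mul, Matrix.one_mul]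
    rw [h1] at hw' hw''
    rw [Matrix.conjTranspose_mul] at hw''
    simp only [Matrix.mul_assoc] at hw' hw'' ⊢
    rw [hw'', hw']

/-- A linear functional that is constant on the Choi matrices of causal maps `B ⟶ C` only depends
on the part with `C` traced out. -/
theorem functional_causal {B C : Type} [Fintype B] [Fintype C] [DecidableEq B] [DecidableEq C]
    (T : Matrix (B × C) (B × C) ℂ →ₗ[ℂ] ℂ) (t : ℂ)
    (h : ∀ F : Matrix (B × C) (B × C) ℂ, F.PosSemidef → ptrace F = 1 → T F = t) (c₀ : C) :
    (∀ (E : Matrix B B ℂ) (σ : Matrix C C ℂ),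
      T (E ⊗ₖ σ) = σ.trace * T (E ⊗ₖ Matrix.single c₀ c₀ 1)) ∧
    T ((1 : Matrix B B ℂ) ⊗ₖ Matrix.single c₀ c₀ 1) = t := by
  have hpt' : ∀ F G : Matrix (B × C) (B × C) ℂ, ptrace (F + G) = ptrace F + ptrace G := by
    intro F G
    ext x y
    simp [ptrace, Finset.sum_add_distrib]
  have hs := posSemidef_single c₀
  have hst : (Matrix.single c₀ c₀ (1 : ℂ)).trace = 1 := by simp
  -- This is the Choi matrix of the map that discards its input and prepares σ.
  have h1 : ∀ σ : Matrix C C ℂ, σ.PosSemidef → σ.trace = 1 → T (1 ⊗ₖ σ) = t := fun σ hσ ht =>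
    h _ (Matrix.PosSemidef.one.kronecker hσ) (by rw [ptrace_kronecker, ht, one_smul])
  refine ⟨fun E σ => ?_, h1 _ hs hst⟩
  have key : ∀ (E : Matrix B B ℂ), E.PosSemidef → E.trace = 1 →
      ∀ σ : Matrix C C ℂ, σ.PosSemidef → σ.trace = 1 →
      T (E ⊗ₖ σ) = T (E ⊗ₖ Matrix.single c₀ c₀ 1) := by
    intro E hE hEt σ hσ hσt
    -- A measure-and-prepare map: σ on outcome E, the fixed state on 1 - E. Subtracting the value at
    -- 1 ⊗ the fixed state leaves the claim.
    have h2 := h (E ⊗ₖ σ + (1 - E) ⊗ₖ Matrix.single c₀ c₀ 1)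
      ((hE.kronecker hσ).add ((posSemidef_one_sub hE hEt).kronecker hs))
      (by rw [hpt', ptrace_kronecker, ptrace_kronecker, hσt, hst, one_smul, one_smul,
        add_sub_cancel])
    rw [sub_kronecker, map_add, map_sub, h1 _ hs hst] at h2
    linear_combination h2
  -- Both sides are bilinear in E and σ, so agreement on density matrices in each variable suffices.
  let L₁ : Matrix B B ℂ →ₗ[ℂ] Matrix C C ℂ →ₗ[ℂ] ℂ :=
    LinearMap.mk₂ ℂ (fun E σ => T (E ⊗ₖ σ))
      (fun _ _ _ => by rw [Matrix.add_kronecker, map_add])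
      (fun _ _ _ => by rw [Matrix.smul_kronecker, map_smul])
      (fun _ _ _ => by rw [Matrix.kronecker_add, map_add])
      (fun _ _ _ => by rw [Matrix.kronecker_smul, map_smul])
  let L₂ : Matrix B B ℂ →ₗ[ℂ] Matrix C C ℂ →ₗ[ℂ] ℂ :=
    (L₁.flip (Matrix.single c₀ c₀ 1)).smulRight (Matrix.traceLinearMap C ℂ ℂ)
  have hL : L₁ = L₂ := by
    refine ext_density fun E hE hEt => ext_density fun σ hσ hσt => ?_
    change T (E ⊗ₖ σ) = T (E ⊗ₖ Matrix.single c₀ c₀ 1) • σ.trace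
    rw [key E hE hEt σ hσ hσt, hσt, smul_eq_mul, mul_one]
  refine (LinearMap.congr_fun (LinearMap.congr_fun hL E) σ).trans ?_
  change T (E ⊗ₖ Matrix.single c₀ c₀ 1) • σ.trace = _
  rw [smul_eq_mul, mul_comm]

/-- A matrix whose pairing with the Choi matrices of all causal maps `B ⟶ C` is constant is a
matrix on `B` next to the identity on `C`. -/
theorem pairing_causal {B C : Type} [Fintype B] [Fintype C] [DecidableEq B] [DecidableEq C]
    (S : Matrix (B × C) (B × C) ℂ) (t : ℂ)
    (h : ∀ F : Matrix (B × C) (B × C) ℂ, F.PosSemidef → ptrace F = 1 →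
      ∑ x, ∑ y, S x y * F x y = t) (c₀ : C) :
    (∀ b b' c c', S (b, c) (b', c') = if c = c' then S (b, c₀) (b', c₀) else 0) ∧
    ∑ b, S (b, c₀) (b, c₀) = t := by
  let T : Matrix (B × C) (B × C) ℂ →ₗ[ℂ] ℂ :=
    { toFun := fun F => ∑ x, ∑ y, S x y * F x y
      map_add' := fun F G => by simp [mul_add, Finset.sum_add_distrib]
      map_smul' := fun r F => by simp [Finset.mul_sum, mul_left_comm] }
  have hT : ∀ b b' c c', T (Matrix.single b b' 1 ⊗ₖ Matrix.single c c' 1) =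
      S (b, c) (b', c') := by
    intro b b' c c'
    rw [Matrix.single_kronecker_single, mul_one]
    change ∑ x : B × C, ∑ y : B × C, S x y * Matrix.single (b, c) (b', c') (1 : ℂ) x y = _
    simp [Matrix.single_apply, ite_and]
  obtain ⟨h1, h2⟩ := functional_causal T t h c₀
  constructor
  · intro b b' c c'
    rw [← hT, h1, hT]
    by_cases hc : c = c'
    · subst hc; simp
    · simp [hc]
  · rw [← h2]
    have h3 : (1 : Matrix B B ℂ) = ∑ b : B, Matrix.single b b 1 := Matrix.sum_single_one.symm
    have h4 : (∑ b : B, Matrix.single b b (1 : ℂ)) ⊗ₖ Matrix.single c₀ c₀ (1 : ℂ) =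
        ∑ b : B, Matrix.single b b (1 : ℂ) ⊗ₖ Matrix.single c₀ c₀ (1 : ℂ) := by
      ext x y
      simp [Matrix.sum_apply, Finset.sum_mul]
    rw [h3, h4, map_sum]
    exact Finset.sum_congr rfl fun b _ => (hT _ _ _ _).symm

end LinearAlgebra

/-! ### The Choi correspondence for linear maps -/

section Choi

variable {m n : Type}

/-- The Choi matrix of a linear map. -/
def choi [DecidableEq m] (f : Matrix m m ℂ →ₗ[ℂ] Matrix n n ℂ) : Matrix (m × n) (m × n) ℂ :=
  Matrix.of fun x y => f (Matrix.single x.1 y.1 1) x.2 y.2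

theorem apply_eq_sum_choi [Fintype m] [DecidableEq m] (f : Matrix m m ℂ →ₗ[ℂ] Matrix n n ℂ)
    (M : Matrix m m ℂ) (a b : n) : f M a b = ∑ i, ∑ j, M i j * choi f (i, a) (j, b) := by
  conv_lhs => rw [Matrix.matrix_eq_sum_single M]
  simp only [map_sum, Matrix.sum_apply]
  refine Finset.sum_congr rfl fun i _ => Finset.sum_congr rfl fun j _ => ?_
  have : Matrix.single i j (M i j) = M i j • Matrix.single i j (1 : ℂ) := by simp
  rw [this, map_smul]
  rfl

theorem choi_injective [Fintype m] [DecidableEq m] {f g : Matrix m m ℂ →ₗ[ℂ] Matrix n n ℂ}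
    (h : choi f = choi g) : f = g := by
  refine LinearMap.ext fun M => Matrix.ext fun a b => ?_
  rw [apply_eq_sum_choi, apply_eq_sum_choi, h]

/-- The Choi matrix is id ⊗ f applied to the rank-one positive matrix of the vector ∑ |i⟩|i⟩. -/
theorem IsCP.choi_posSemidef [Fintype m] [DecidableEq m]
    {f : Matrix m m ℂ →ₗ[ℂ] Matrix n n ℂ} (h : IsCP f) : (choi f).PosSemidef := by
  have hb : (Matrix.vecMulVec (fun x : m × m => if x.1 = x.2 then (1 : ℂ) else 0)
      (star fun x : m × m => if x.1 = x.2 then (1 : ℂ) else 0)).PosSemidef :=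
    Matrix.posSemidef_vecMulVec_self_star _
  convert h.lTensor_posSemidef hb using 1
  ext x y
  have : Matrix.single x.1 y.1 (1 : ℂ) = Matrix.of fun i j =>
      Matrix.vecMulVec (fun x : m × m => if x.1 = x.2 then (1 : ℂ) else 0)
      (star fun x : m × m => if x.1 = x.2 then (1 : ℂ) else 0) (x.1, i) (y.1, j) := by
    ext i j
    by_cases h1 : x.1 = i <;> by_cases h2 : y.1 = j <;>
      simp [Matrix.vecMulVec_apply, h1, h2]
  change f (Matrix.single x.1 y.1 1) x.2 y.2 = _
  rw [this]
  rfl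

/-- The linear map with a given Choi matrix. -/
def linOfChoi [Fintype m] (J : Matrix (m × n) (m × n) ℂ) : Matrix m m ℂ →ₗ[ℂ] Matrix n n ℂ where
  toFun M := Matrix.of fun a b => ∑ i, ∑ j, M i j * J (i, a) (j, b)
  map_add' M N := by ext a b; simp [add_mul, Finset.sum_add_distrib]
  map_smul' c M := by ext a b; simp [Finset.mul_sum, mul_assoc]

theorem choi_linOfChoi [Fintype m] [DecidableEq m] (J : Matrix (m × n) (m × n) ℂ) :
    choi (linOfChoi J) = J := by
  ext x y
  simp [choi, linOfChoi, Matrix.single_apply, ite_and]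

/-- Factor J = V Vᴴ. Each column of V, reshaped into a matrix, is a Kraus operator, so the map is a
sum of conjugations. -/
theorem isCP_linOfChoi [Fintype m] [Fintype n] [DecidableEq m] [DecidableEq n]
    {J : Matrix (m × n) (m × n) ℂ} (hJ : J.PosSemidef) : IsCP (linOfChoi J) := by
  obtain ⟨Z, V, -, rfl, -⟩ := exists_support_factor hJ
  have : linOfChoi (V * Vᴴ) = ∑ z, linOfChoi (Matrix.of fun x y => V x z * star (V y z)) := by
    refine LinearMap.ext fun M => Matrix.ext fun a b => ?_
    simp only [LinearMap.sum_apply, Matrix.sum_apply]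
    simp only [linOfChoi, LinearMap.coe_mk, AddHom.coe_mk, Matrix.of_apply, Matrix.mul_apply,
      Matrix.conjTranspose_apply, Finset.mul_sum]
    rw [Finset.sum_comm]
    simp only [Finset.sum_comm (s := (Finset.univ : Finset Z.idx))]
    rw [Finset.sum_comm]
  rw [this]
  refine IsCP.sum _ _ fun z => isCP_conj (Matrix.of fun a i => V (i, a) z) _ fun M => ?_
  ext a b
  simp only [linOfChoi, LinearMap.coe_mk, AddHom.coe_mk, Matrix.of_apply, Matrix.mul_apply,
    Matrix.conjTranspose_apply, Finset.sum_mul]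
  rw [Finset.sum_comm]
  refine Finset.sum_congr rfl fun i _ => Finset.sum_congr rfl fun j _ => ?_
  ring

end Choi

/-! ### Categorical operations as index contractions -/

section Entries

variable {A B C D : CPM}

/-- The Choi matrix of a morphism. -/
def Choi (f : A ⟶ B) : Matrix (A.idx × B.idx) (A.idx × B.idx) ℂ := choi (Hom.lin f)

theorem lin_apply (f : A ⟶ B) (M : A.Alg) (a b : B.idx) :
    Hom.lin f M a b = ∑ i, ∑ j, M i j * Choi f (i, a) (j, b) := apply_eq_sum_choi _ _ _ _

theorem Choi_posSemidef (f : A ⟶ B) : (Choi f).PosSemidef := (Hom.isCP f).choi_posSemidef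

theorem Choi_injective {f g : A ⟶ B} (h : Choi f = Choi g) : f = g := hom_ext (choi_injective h)

/-- The morphism with a given positive Choi matrix. -/
def ofChoi {J : Matrix (A.idx × B.idx) (A.idx × B.idx) ℂ} (hJ : J.PosSemidef) : A ⟶ B :=
  ⟨linOfChoi J, isCP_linOfChoi hJ⟩

@[simp] theorem Choi_ofChoi {J : Matrix (A.idx × B.idx) (A.idx × B.idx) ℂ} (hJ : J.PosSemidef) :
    Choi (ofChoi (A := A) (B := B) hJ) = J := choi_linOfChoi J

/-- Both sides say that f sends each matrix unit to a matrix of the same trace. -/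
theorem isCausal_iff (f : A ⟶ B) : Precausal.IsCausal discard f ↔ ptrace (Choi f) = 1 := by
  constructor
  · intro h
    ext i j
    have h1 := congrFun (congrFun (LinearMap.congr_fun (congrArg Hom.lin h)
      (Matrix.single i j 1)) ()) ()
    change (Hom.lin f (Matrix.single i j 1)).trace = (Matrix.single i j (1 : ℂ)).trace at h1
    change (Hom.lin f (Matrix.single i j 1)).trace = _
    rw [h1]
    by_cases hij : i = j
    · subst hij; simp
    · simp [hij]
  · intro h
    refine hom_ext (LinearMap.ext fun M => Matrix.ext fun x y => ?_)
    change ∑ b, Hom.lin f M b b = M.trace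
    simp only [lin_apply]
    rw [Finset.sum_comm]
    have h1 : ∀ i j, ∑ b, Choi f (i, b) (j, b) = if i = j then 1 else 0 := fun i j => by
      have := congrFun (congrFun h i) j
      simpa [ptrace, Matrix.one_apply] using this
    refine Finset.sum_congr rfl fun i _ => ?_
    rw [Finset.sum_comm]
    simp [← Finset.mul_sum, h1]

/-- The matrix of a state. -/
def mat (s : 𝟙_ CPM ⟶ A) : Matrix A.idx A.idx ℂ := Hom.lin s 1

theorem Choi_state (s : 𝟙_ CPM ⟶ A) (i j : Unit) (a b : A.idx) :
    Choi s (i, a) (j, b) = mat s a b := by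
  have : Matrix.single i j (1 : ℂ) = 1 := by ext; simp
  change Hom.lin s (Matrix.single i j (1 : ℂ)) a b = _
  rw [this]
  rfl

theorem state_apply (s : 𝟙_ CPM ⟶ A) (c : (𝟙_ CPM).Alg) (a b : A.idx) :
    Hom.lin s c a b = c () () * mat s a b := by
  have : c = c () () • (1 : (𝟙_ CPM).Alg) := by
    ext i j
    have : (1 : Matrix Unit Unit ℂ) i j = 1 := Matrix.one_apply_eq ()
    change c i j = c () () * (1 : Matrix Unit Unit ℂ) i j
    rw [this, mul_one]
    rfl
  conv_lhs => rw [this, map_smul]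
  rfl

theorem mat_injective {s t : 𝟙_ CPM ⟶ A} (h : mat s = mat t) : s = t :=
  hom_ext (LinearMap.ext fun c => Matrix.ext fun a b => by rw [state_apply, state_apply, h])

theorem mat_posSemidef (s : 𝟙_ CPM ⟶ A) : (mat s).PosSemidef := by
  have h := (Choi_posSemidef s).submatrix (fun a => ((), a))
  convert h using 1
  ext a b
  exact (Choi_state s _ _ a b).symm

theorem exists_state {M : Matrix A.idx A.idx ℂ} (hM : M.PosSemidef) :
    ∃ s : 𝟙_ CPM ⟶ A, mat s = M := by
  refine ⟨ofChoi (A := 𝟙_ CPM) (hM.submatrix Prod.snd), ?_⟩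
  ext a b
  rw [← Choi_state _ () (), Choi_ofChoi]
  rfl

theorem isCausal_state_iff (s : 𝟙_ CPM ⟶ A) :
    Precausal.IsCausal discard s ↔ (mat s).trace = 1 := by
  rw [isCausal_iff, ← Matrix.ext_iff]
  simp only [ptrace, Matrix.of_apply]
  constructor
  · intro h
    have := h () ()
    simp only [Choi_state] at this
    exact this
  · intro h i j
    simp only [Choi_state]
    exact h

/-- The unnormalised cup feeds exactly the matrix units into f, so bending a wire introduces neither
a factor nor a transpose. -/
theorem mat_stateOf (f : A ⟶ B) : mat (Precausal.stateOf f) = Choi f := by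
  ext x y
  change Hom.lin f (Matrix.of fun i j => if x.1 = i ∧ y.1 = j then
    (1 : Matrix Unit Unit ℂ) () () else 0) x.2 y.2 = Hom.lin f (Matrix.single x.1 y.1 1) x.2 y.2
  congr 3

theorem Choi_processOf (s : 𝟙_ CPM ⟶ (ᘁA) ⊗ B) : Choi (Precausal.processOf s) = mat s := by
  ext x y
  change (∑ i, ∑ j, Hom.lin s (Matrix.of fun _ _ => Matrix.single x.1 y.1 (1 : ℂ) i j)
    (i, x.2) (j, y.2)) = mat s x y
  have h : ∀ i j : A.idx, Hom.lin s (Matrix.of fun _ _ => Matrix.single x.1 y.1 (1 : ℂ) i j)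
      (i, x.2) (j, y.2) =
      if x.1 = i then if y.1 = j then mat s (i, x.2) (j, y.2) else 0 else 0 := by
    intro i j
    rw [state_apply]
    change Matrix.single x.1 y.1 (1 : ℂ) i j * _ = _
    by_cases h1 : x.1 = i <;> by_cases h2 : y.1 = j <;> simp [h1, h2]
  simp only [h]
  simp

/-- The cap matches rows with rows and columns with columns, hence the entrywise pairing, as in
`pairing_causal`. -/
theorem effectOf_apply (f : A ⟶ B) (M : (A ⊗ (ᘁB)).Alg) :
    Hom.lin (Precausal.effectOf f) M () () =
      ∑ x : A.idx × B.idx, ∑ y : A.idx × B.idx, M x y * Choi f x y := by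
  change (∑ i : B.idx, ∑ j : B.idx,
    Hom.lin f (Matrix.of fun k l => M (k, i) (l, j)) i j) = _
  simp only [lin_apply, Fintype.sum_prod_type]
  simp only [Matrix.of_apply]
  exact (Finset.sum_congr rfl fun x _ => Finset.sum_comm.trans
    (Finset.sum_congr rfl fun i _ => Finset.sum_comm)).trans Finset.sum_comm

theorem Choi_plug (w : 𝟙_ CPM ⟶ (ᘁA) ⊗ (B ⊗ ((ᘁC) ⊗ D))) (f : B ⟶ C) (a a' : A.idx)
    (d d' : D.idx) : Choi (Precausal.plug w f) (a, d) (a', d') =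
      ∑ x : B.idx × C.idx, ∑ y : B.idx × C.idx,
        mat w (a, (x.1, (x.2, d))) (a', (y.1, (y.2, d'))) * Choi f x y := by
  rw [Precausal.plug, Choi_processOf]
  exact effectOf_apply f (Matrix.of fun x y => mat w (a, (x.1, (x.2, d))) (a', (y.1, (y.2, d'))))

theorem bendInput_apply {Z : CPM} (f : C ⊗ Z ⟶ D) (M : Z.Alg) (c c' : C.idx) (d d' : D.idx) :
    Hom.lin (Precausal.bendInput f) M (c, d) (c', d') =
      ∑ z, ∑ z', M z z' * Choi f ((c, z), d) ((c', z'), d') := by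
  change Hom.lin f (Matrix.of fun (x y : C.idx × Z.idx) =>
    if c = x.1 ∧ c' = y.1 then M x.2 y.2 else 0) d d' = _
  rw [lin_apply]
  change (∑ i : C.idx × Z.idx, ∑ j : C.idx × Z.idx, _) = _
  simp only [Fintype.sum_prod_type, Matrix.of_apply]
  simp [ite_and]

/-- The memory wire becomes a contraction over Z, of the same shape as in `Choi_semilocal`; hence
`exists_realization` serves both axioms. -/
theorem mat_combOf {Z : CPM} (f₁ : A ⟶ B ⊗ Z) (f₂ : C ⊗ Z ⟶ D)
    (a a' : A.idx) (b b' : B.idx) (c c' : C.idx) (d d' : D.idx) :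
    mat (Precausal.combOf f₁ f₂) (a, (b, (c, d))) (a', (b', (c', d'))) =
      ∑ z, ∑ z', Choi f₁ (a, (b, z)) (a', (b', z')) * Choi f₂ ((c, z), d) ((c', z'), d') := by
  rw [Precausal.combOf, mat_stateOf]
  exact bendInput_apply f₂ (Matrix.of fun z z' => Choi f₁ (a, (b, z)) (a', (b', z'))) c c' d d'

theorem Choi_semilocal {A B A' B' Z : CPM} (f₁ : A ⟶ A' ⊗ Z) (f₂ : Z ⊗ B ⟶ B')
    (a c : A.idx) (b d : B.idx) (a' c' : A'.idx) (b' d' : B'.idx) :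
    Choi (f₁ ▷ B ≫ (α_ A' Z B).hom ≫ A' ◁ f₂) ((a, b), (a', b')) ((c, d), (c', d')) =
      ∑ z, ∑ z', Choi f₁ (a, (a', z)) (c, (c', z')) * Choi f₂ ((z, b), b') ((z', d), d') := by
  change Hom.lin f₂ (Matrix.of fun (x y : Z.idx × B.idx) => Hom.lin f₁ (Matrix.of fun i j =>
    Matrix.single (a, b) (c, d) (1 : ℂ) (i, x.2) (j, y.2)) (a', x.1) (c', y.1)) b' d' = _
  have h : ∀ x y : Z.idx × B.idx, Hom.lin f₁ (Matrix.of fun i j =>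
    Matrix.single (a, b) (c, d) (1 : ℂ) (i, x.2) (j, y.2)) (a', x.1) (c', y.1) =
      if b = x.2 then if d = y.2 then Choi f₁ (a, (a', x.1)) (c, (c', y.1)) else 0 else 0 := by
    intro x y
    rw [lin_apply]
    simp only [Matrix.of_apply, Matrix.single_apply, Prod.mk.injEq]
    by_cases h1 : b = x.2 <;> by_cases h2 : d = y.2 <;> simp [h1, h2, ite_and]
  simp only [h]
  rw [lin_apply]
  change (∑ i : Z.idx × B.idx, ∑ j : Z.idx × B.idx, _) = _
  simp only [Fintype.sum_prod_type, Matrix.of_apply]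
  simp

end Entries

/-! ### Verification of the axioms -/

section Axioms

variable {A B C D : CPM}

theorem axiomC1 : Precausal.AxiomC1 discard := by
  refine ⟨fun A B => hom_ext₂ fun a b => ?_, hom_ext (LinearMap.ext fun M => ?_)⟩
  · rw [lin_comp, LinearMap.comp_apply, tensorHom_kr, leftUnitor_kr]
    ext x y
    exact Matrix.trace_kronecker a b
  · ext x y
    exact Fintype.sum_unique (fun i : Unit => M i i)

theorem mat_dimension (A : CPM) :
    mat (Precausal.dimension discard A) = (Fintype.card A.idx : ℂ) • (1 : Matrix Unit Unit ℂ) := by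
  ext x y
  rw [Matrix.smul_apply, show x = y from rfl, Matrix.one_apply_eq]
  change (∑ k : A.idx, ∑ i : A.idx, if i = k ∧ i = k then (1 : ℂ) else 0) = _
  simp

theorem mat_loop (A : CPM) :
    mat (Precausal.loop A) = ((Fintype.card A.idx : ℂ) ^ 2) • (1 : Matrix Unit Unit ℂ) := by
  ext x y
  rw [Matrix.smul_apply, show x = y from rfl, Matrix.one_apply_eq]
  change (∑ i : A.idx, ∑ j : A.idx, if i = i ∧ j = j then (1 : ℂ) else 0) = _
  simp [sq]

theorem isIso_scalar {s : 𝟙_ CPM ⟶ 𝟙_ CPM} {c : ℂ} (hc : 0 ≤ c) (h0 : c ≠ 0)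
    (h : mat s = c • (1 : Matrix Unit Unit ℂ)) : IsIso s := by
  -- The inverse scalar must itself be completely positive, which is where 0 ≤ c enters.
  obtain ⟨t, ht⟩ := exists_state (A := 𝟙_ CPM)
    ((Matrix.PosSemidef.one (n := Unit) (R := ℂ)).smul (inv_nonneg.2 hc))
  have hid : mat (𝟙 (𝟙_ CPM)) = (1 : Matrix Unit Unit ℂ) := rfl
  have key : ∀ {p q : 𝟙_ CPM ⟶ 𝟙_ CPM} {a b : ℂ}, mat p = a • (1 : Matrix Unit Unit ℂ) →
      mat q = b • (1 : Matrix Unit Unit ℂ) → a * b = 1 → p ≫ q = 𝟙 _ := by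
    intro p q a b hp hq hab
    apply mat_injective
    ext x y
    change Hom.lin q (mat p) x y = _
    rw [state_apply, hp, hq, hid, Matrix.smul_apply, Matrix.smul_apply, show x = y from rfl]
    simp [hab]
  exact ⟨t, key h ht (mul_inv_cancel₀ h0), key ht h (inv_mul_cancel₀ h0)⟩

/-- Over an empty basis the algebra is zero, so zero is the only map in or out and the object is a
zero object. -/
theorem card_ne_zero (hA : ¬ Limits.IsZero A) : (Fintype.card A.idx : ℂ) ≠ 0 := by
  intro h
  have hE : IsEmpty A.idx := Fintype.card_eq_zero_iff.1 (by exact_mod_cast h)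
  refine hA ⟨fun Y => ⟨⟨⟨⟨0, ?_⟩⟩, fun f => ?_⟩⟩, fun Y => ⟨⟨⟨⟨0, ?_⟩⟩, fun f => ?_⟩⟩⟩
  · exact fun k M _ => Matrix.PosSemidef.zero
  · exact hom_ext (LinearMap.ext fun M => by
      rw [show M = 0 from Matrix.ext fun i => hE.elim i, map_zero, map_zero])
  · exact fun k M _ => Matrix.PosSemidef.zero
  · exact hom_ext (LinearMap.ext fun M => Matrix.ext fun i => hE.elim i)

theorem axiomC3 : Precausal.AxiomC3 discard := by
  intro A B f g h
  refine hom_ext (ext_density fun M hM hMt => ?_)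
  obtain ⟨s, rfl⟩ := exists_state hM
  exact LinearMap.congr_fun (congrArg Hom.lin (h s ((isCausal_state_iff s).2 hMt))) 1

/-- A comb with the right marginals is realized by two causal maps with a memory. -/
theorem exists_realization
    {W : Matrix (((A.idx × B.idx) × C.idx) × D.idx) (((A.idx × B.idx) × C.idx) × D.idx) ℂ}
    {u : Matrix (A.idx × B.idx) (A.idx × B.idx) ℂ} (hW : W.PosSemidef) (hu : u.PosSemidef)
    (hu1 : ptrace u = 1) (h : ptrace W = u ⊗ₖ (1 : Matrix C.idx C.idx ℂ)) :
    ∃ (Z : CPM) (f₁ : A ⟶ B ⊗ Z) (f₂ : Z ⊗ C ⟶ D), Precausal.IsCausal discard f₁ ∧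
      Precausal.IsCausal discard f₂ ∧ ∀ a a' b b' c c' d d',
      W (((a, b), c), d) (((a', b'), c'), d') =
        ∑ z, ∑ z', Choi f₁ (a, (b, z)) (a', (b', z')) * Choi f₂ ((z, c), d) ((z', c'), d') := by
  obtain ⟨Z, V, N, rfl, hN, hN1, rfl⟩ := exists_memory hW hu h
  -- V reshaped into a vector of A ⊗ B ⊗ Z gives a rank-one Choi matrix. Tracing out Z gives u, and
  -- then B gives 1, so the map is causal.
  let v : A.idx × (B.idx × Z.idx) → ℂ := fun x => V (x.1, x.2.1) x.2.2
  have hv : (Matrix.vecMulVec v (star v)).PosSemidef := Matrix.posSemidef_vecMulVec_self_star v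
  refine ⟨Z, ofChoi (A := A) (B := B ⊗ Z) hv, ofChoi (A := Z ⊗ C) (B := D) hN,
    (isCausal_iff _).2 ?_, (isCausal_iff _).2 ?_, ?_⟩
  · rw [Choi_ofChoi, ← hu1]
    ext a a'
    change ∑ x : B.idx × Z.idx, V (a, x.1) x.2 * star (V (a', x.1) x.2) = _
    rw [Fintype.sum_prod_type]
    rfl
  · rw [Choi_ofChoi]
    exact hN1
  · intro a a' b b' c c' d d'
    rw [Choi_ofChoi, Choi_ofChoi]
    have hS : ∀ x z c c' d d', ((V ⊗ₖ (1 : Matrix C.idx C.idx ℂ)) ⊗ₖ (1 : Matrix D.idx D.idx ℂ))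
        ((x, c), d) ((z, c'), d') = if d = d' then if c = c' then V x z else 0 else 0 := by
      intro x z c c' d d'
      simp [Matrix.kroneckerMap_apply, Matrix.one_apply]
    simp only [Matrix.mul_apply, Matrix.conjTranspose_apply, Fintype.sum_prod_type, hS,
      ite_mul, zero_mul, Finset.sum_ite_eq, Finset.mem_univ, if_true, apply_ite star,
      star_zero, mul_ite, mul_zero]
    simp only [Finset.sum_mul]
    rw [Finset.sum_comm]
    refine Finset.sum_congr rfl fun z _ => Finset.sum_congr rfl fun z' _ => ?_
    simp only [Matrix.vecMulVec_apply, v, Pi.star_apply]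
    ring

/-- On matrix units the hypothesis says that tracing B' out of the Choi matrix of Φ leaves that of
Φ' tensored with 1 on B, the marginal `exists_realization` asks for. -/
theorem axiomC4' : Precausal.AxiomC4' discard := by
  rintro A B A' B' Φ ⟨Φ', hΦ', h⟩
  let e : ((A.idx × A'.idx) × B.idx) × B'.idx → (A.idx × B.idx) × (A'.idx × B'.idx) :=
    fun x => ((x.1.1.1, x.1.2), (x.1.1.2, x.2))
  obtain ⟨Z, f₁, f₂, h₁, h₂, hW⟩ := exists_realization (A := A) (B := A') (C := B) (D := B')
    ((Choi_posSemidef Φ).submatrix e) (Choi_posSemidef Φ') ((isCausal_iff _).1 hΦ') (by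
      ext ⟨⟨a, a'⟩, b⟩ ⟨⟨c, c'⟩, d⟩
      have h1 := congrFun (congrFun (LinearMap.congr_fun (congrArg Hom.lin h)
        (kr (Matrix.single a c (1 : ℂ)) (Matrix.single b d (1 : ℂ)))) (a', ())) (c', ())
      rw [tensorHom_kr] at h1
      have h2 : kr (A := A) (B := B) (Matrix.single a c (1 : ℂ)) (Matrix.single b d (1 : ℂ)) =
          Matrix.single (a, b) (c, d) (1 : ℂ) := by
        rw [kr, Matrix.single_kronecker_single, mul_one]
      rw [h2] at h1
      refine Eq.trans h1 ?_
      change _ * (Matrix.single b d (1 : ℂ)).trace = _ * (1 : Matrix B.idx B.idx ℂ) b d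
      congr 1
      by_cases hbd : b = d
      · subst hbd; simp
      · simp [hbd])
  refine ⟨Z, f₁, f₂, h₁, h₂, Choi_injective ?_⟩
  ext ⟨⟨a, b⟩, ⟨a', b'⟩⟩ ⟨⟨c, d⟩, ⟨c', d'⟩⟩
  rw [Choi_semilocal]
  exact hW a c a' c' b d b' d'

/-- `exists_realization` puts the memory to the left of C, combs put it to the right. -/
theorem Choi_swap_comp {Z : CPM} (f : Z ⊗ C ⟶ D) (c c' : C.idx) (z z' : Z.idx) (d d' : D.idx) :
    Choi ((swap C Z).hom ≫ f) ((c, z), d) ((c', z'), d') =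
      Choi f ((z, c), d) ((z', c'), d') := by
  have h2 : kr (A := C) (B := Z) (Matrix.single c c' (1 : ℂ)) (Matrix.single z z' (1 : ℂ)) =
      Matrix.single (c, z) (c', z') (1 : ℂ) := by
    rw [kr, Matrix.single_kronecker_single, mul_one]
  have h3 : kr (A := Z) (B := C) (Matrix.single z z' (1 : ℂ)) (Matrix.single c c' (1 : ℂ)) =
      Matrix.single (z, c) (z', c') (1 : ℂ) := by
    rw [kr, Matrix.single_kronecker_single, mul_one]
  change Hom.lin f (Hom.lin (swap C Z).hom (Matrix.single (c, z) (c', z') (1 : ℂ))) d d' = _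
  rw [← h2, swap_kr, h3]
  rfl

theorem isCausal_swap_comp {Z : CPM} {f : Z ⊗ C ⟶ D} (h : Precausal.IsCausal discard f) :
    Precausal.IsCausal discard ((swap C Z).hom ≫ f) := by
  rw [Precausal.IsCausal] at h ⊢
  rw [Category.assoc, h]
  refine hom_ext₂ fun a b => ?_
  rw [lin_comp, LinearMap.comp_apply, swap_kr]
  ext x y
  exact (Matrix.trace_kronecker b a).trans
    ((mul_comm _ _).trans (Matrix.trace_kronecker a b).symm)

/-- For fixed indices a, a', tracing D out of w gives a matrix on B ⊗ C whose pairing with every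
causal Choi matrix is the (a, a') entry of the identity, so `pairing_causal` applies entry by entry.
-/
theorem axiomC4 : Precausal.AxiomC4 discard := by
  intro A B C D w hw
  let e : ((A.idx × B.idx) × C.idx) × D.idx → A.idx × (B.idx × (C.idx × D.idx)) :=
    fun x => (x.1.1.1, (x.1.1.2, (x.1.2, x.2)))
  let W := (mat w).submatrix e e
  have hWp : W.PosSemidef := (mat_posSemidef w).submatrix e
  let S (a a' : A.idx) : Matrix (B.idx × C.idx) (B.idx × C.idx) ℂ := Matrix.of fun x y =>
    ptrace W ((a, x.1), x.2) ((a', y.1), y.2)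
  have hS : ∀ (a a' : A.idx) (F : Matrix (B.idx × C.idx) (B.idx × C.idx) ℂ), F.PosSemidef →
      ptrace F = 1 → ∑ x : B.idx × C.idx, ∑ y : B.idx × C.idx, S a a' x y * F x y =
        (1 : Matrix A.idx A.idx ℂ) a a' := by
    intro a a' F hF hF1
    have h1 := (isCausal_iff _).1 (hw (ofChoi (A := B) (B := C) hF)
      ((isCausal_iff _).2 (by rw [Choi_ofChoi, hF1])))
    have h2 := congrFun (congrFun h1 a) a'
    rw [← h2]
    symm
    simp only [ptrace, Matrix.of_apply, Choi_plug, Choi_ofChoi]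
    rw [Finset.sum_comm]
    refine Finset.sum_congr rfl fun x _ => ?_
    rw [Finset.sum_comm]
    refine Finset.sum_congr rfl fun y _ => ?_
    rw [← Finset.sum_mul]
    rfl
  have key : ∃ u : Matrix (A.idx × B.idx) (A.idx × B.idx) ℂ, u.PosSemidef ∧ ptrace u = 1 ∧
      ptrace W = u ⊗ₖ (1 : Matrix C.idx C.idx ℂ) := by
    -- `pairing_causal` needs a basis vector of C. For C empty the marginal condition is vacuous and
    -- any causal u will do. If B is empty too, the zero map is causal and the hypothesis forces A
    -- to be empty.
    rcases isEmpty_or_nonempty C.idx with hC | ⟨⟨c₀⟩⟩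
    · rcases isEmpty_or_nonempty B.idx with hB | ⟨⟨b₀⟩⟩
      · have hA : IsEmpty A.idx := ⟨fun a => by
          have := hS a a 0 Matrix.PosSemidef.zero (Matrix.ext fun i => hB.elim i)
          simp at this⟩
        exact ⟨0, Matrix.PosSemidef.zero, Matrix.ext fun i => hA.elim i,
          Matrix.ext fun i => hC.elim i.2⟩
      · refine ⟨1 ⊗ₖ Matrix.single b₀ b₀ 1,
          Matrix.PosSemidef.one.kronecker (posSemidef_single b₀), ?_,
          Matrix.ext fun i => hC.elim i.2⟩
        rw [ptrace_kronecker]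
        simp
    · have h1 := fun a a' => pairing_causal (S a a') _ (hS a a') c₀
      refine ⟨(ptrace W).submatrix (fun x => (x, c₀)) (fun x => (x, c₀)),
        (posSemidef_ptrace hWp).submatrix _, ?_, ?_⟩
      · ext a a'
        exact (h1 a a').2
      · ext ⟨⟨a, b⟩, c⟩ ⟨⟨a', b'⟩, c'⟩
        refine ((h1 a a').1 b b' c c').trans ?_
        rw [Matrix.kroneckerMap_apply, Matrix.one_apply, mul_ite, mul_one, mul_zero]
        rfl
  obtain ⟨u, hu, hu1, hWu⟩ := key
  obtain ⟨Z, f₁, f₂, h₁, h₂, hW⟩ := exists_realization hWp hu hu1 hWu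
  refine ⟨Z, f₁, (swap C Z).hom ≫ f₂, h₁, isCausal_swap_comp h₂, mat_injective ?_⟩
  ext ⟨a, b, c, d⟩ ⟨a', b', c', d'⟩
  rw [mat_combOf]
  simp only [Choi_swap_comp]
  exact hW a a' b b' c c' d d'

theorem mat_discState (B : CPM) :
    mat (Precausal.discState discard B) = (1 : Matrix B.idx B.idx ℂ) := by
  ext b b'
  change mat (Precausal.stateOf (discard B)) (b, ()) (b', ()) = _
  rw [mat_stateOf]
  change (Matrix.single b b' (1 : ℂ)).trace = _
  by_cases hbd : b = b'
  · subst hbd; simp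
  · simp [hbd]

theorem mat_product (s : 𝟙_ CPM ⟶ A) (t : 𝟙_ CPM ⟶ B) :
    mat ((λ_ (𝟙_ CPM)).inv ≫ (s ⊗ₘ t)) = mat s ⊗ₖ mat t := by
  have h : Hom.lin (λ_ (𝟙_ CPM)).inv 1 = kr (A := 𝟙_ CPM) (B := 𝟙_ CPM) 1 1 := by
    ext x y
    rw [show x = y from Subsingleton.elim (α := Unit × Unit) x y]
    exact (mul_one _).symm
  change Hom.lin (s ⊗ₘ t) (Hom.lin (λ_ (𝟙_ CPM)).inv 1) = _
  rw [h, tensorHom_kr]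
  rfl

theorem axiomC5' : Precausal.AxiomC5' discard := by
  intro A B w hw
  have hS : ∀ F : Matrix (A.idx × B.idx) (A.idx × B.idx) ℂ, F.PosSemidef →
      ptrace F = 1 → ∑ x : A.idx × B.idx, ∑ y : A.idx × B.idx, mat w x y * F x y = 1 := by
    intro F hF hF1
    have h1 := hw (ofChoi (A := A) (B := B) hF) ((isCausal_iff _).2 (by rw [Choi_ofChoi, hF1]))
    have h2 := effectOf_apply (ofChoi (A := A) (B := B) hF) (mat w)
    rw [Choi_ofChoi] at h2
    refine h2.symm.trans ?_
    exact congrFun (congrFun (LinearMap.congr_fun (congrArg Hom.lin h1) 1) ()) ()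
  have key : ∃ r : Matrix A.idx A.idx ℂ, r.PosSemidef ∧ r.trace = 1 ∧
      mat w = r ⊗ₖ (1 : Matrix B.idx B.idx ℂ) := by
    -- For B empty any density matrix on A works; if A is empty as well, the zero map is causal and
    -- would give 0 = 1.
    rcases isEmpty_or_nonempty B.idx with hB | ⟨⟨b₀⟩⟩
    · rcases isEmpty_or_nonempty A.idx with hA | ⟨⟨a₀⟩⟩
      · have := hS 0 Matrix.PosSemidef.zero (Matrix.ext fun i => hA.elim i)
        simp at this
      · exact ⟨Matrix.single a₀ a₀ 1, posSemidef_single a₀, by simp,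
          Matrix.ext fun i => hB.elim i.2⟩
    · have h1 := pairing_causal (mat w) 1 hS b₀
      refine ⟨(mat w).submatrix (fun x => (x, b₀)) (fun x => (x, b₀)),
        (mat_posSemidef w).submatrix _, h1.2, ?_⟩
      ext ⟨a, b⟩ ⟨a', b'⟩
      refine (h1.1 a a' b b').trans ?_
      rw [Matrix.kroneckerMap_apply, Matrix.one_apply, mul_ite, mul_one, mul_zero]
      rfl
  obtain ⟨r, hr, hr1, hwr⟩ := key
  obtain ⟨s, rfl⟩ := exists_state hr
  refine ⟨s, (isCausal_state_iff s).2 hr1, mat_injective ?_⟩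
  rw [hwr, mat_product, mat_discState]

end Axioms
end CPM

theorem mainTheorem11 :
    Precausal.IsPrecausal CPM.discard ∧
    Precausal.AxiomC4' CPM.discard ∧
    Precausal.AxiomC5' CPM.discard ∧
    (∀ A : CPM,
      CPM.Hom.lin (Precausal.dimension CPM.discard A) 1 = (Fintype.card A.idx : ℂ) • 1 ∧
      CPM.Hom.lin (Precausal.loop A) 1 = ((Fintype.card A.idx : ℂ) ^ 2) • 1 ∧
      (¬ Limits.IsZero A → IsIso (Precausal.loop A))) := by
  refine ⟨⟨CPM.axiomC1, fun A hA => CPM.isIso_scalar (Nat.cast_nonneg _) (CPM.card_ne_zero hA)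
    (CPM.mat_dimension A), CPM.axiomC3, CPM.axiomC4⟩, CPM.axiomC4', CPM.axiomC5', fun A =>
    ⟨CPM.mat_dimension A, CPM.mat_loop A, fun hA => CPM.isIso_scalar
      (pow_nonneg (Nat.cast_nonneg _) 2) (pow_ne_zero 2 (CPM.card_ne_zero hA)) (CPM.mat_loop A)⟩⟩
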